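/- Simplicial complexes are finite and abstract; $S_n(K)$ is the set of $n$-faces (faces with $n+1$ vertices), and $F\in\partial\bar F$ means that the face $F$ arises from the face $\bar F$ by deleting one vertex. A map $\phi\colon V(K)\to V(M)$ is a $k$-fold (strong) covering, $k\ge 1$, if $K$ is connected, $\phi$ maps faces to faces, for every nonempty face $G$ of $M$ the set $\phi^{-1}(G)$ is the union of the faces $F$ of $K$ with $\phi(F)=G$, these are exactly $k$ in number, pairwise disjoint and mapped bijectively onto $G$ by $\phi$, and whenever $G\in\partial\bar G$ in $M$ and $\phi(F)=G$, there is a face $\bar F$ of $K$ with $F\in\partial\bar F$ and $\phi(\bar F)=\bar G$. For a positive weight $w$ on the faces of a complex $M$ and a function $\omega$ on pairs of faces, with $\omega(F,\bar F)\in\mathbb C\setminus\{0\}$ if $F\in\partial\bar F$ and $\omega(F,\bar F)=0$ otherwise, let $C^n(M,\mathbb C)$ be the space of alternating $n$-cochains with inner product $\langle f,g\rangle=\sum_{F\in S_n(M)}w(F)f([F])\overline{g([F])}$, let $$(\delta_n^\omega f)([v_0,\dots,v_{n+1}])=\sum_{j=0}^{n+1}(-1)^j\,\omega(\{v_0,\dots,\hat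 v_j,\dots,v_{n+1}\},\{v_0,\dots,v_{n+1}\})\,f([v_0,\dots,\hat v_j,\dots,v_{n+1}]),$$ and let $\mathcal L_n^{\rm up}(M,\omega)=(\delta_n^\omega)^*\delta_n^\omega$. Write $\mathcal L_n^{\rm up}(M)$ if $\omega=1$ on all pairs with $F\in\partial\bar F$. $\operatorname{Spec}$ is the multiset of eigenvalues. The $i$-th incidence graph $B_i(M)$ has vertex set $S_i(M)\sqcup S_{i+1}(M)$ and edges $\{F,\bar F\}$ with $F\in\partial\bar F$. Given a permutation $\psi(u,v)\in\mathbb S_k$ for each arc of $B_i(M)$, with $\psi(v,u)=\psi(u,v)^{-1}$, the derived graph $B_i(M)^\psi$ has vertex set $(S_i(M)\sqcup S_{i+1}(M))\times[k]$, and $(u,a),(v,b)$ are adjacent iff $u,v$ are adjacent and $a=\psi(u,v)(b)$. **Theorem.** Let $i\ge 0$, let $\phi\colon K\to M$ be a $k$-fold covering, let $w_K,w_M$ be positive weights with $w_K(F)=w_M(\phi(F))$ for all faces $F$ of $K$, and let $\psi$ be a permutation assignment on $B_i(M)$ with an isomorphism $\eta\colon B_i(M)^\psi\to B_i(K)$ such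 that $\phi(\eta(x,l))=x$ for all $x$ and $l$. Suppose that the group $\Psi_i\le\mathbb S_k$ generated by the permutations $\psi(G,\bar G)$, $G\in S_i(M)$, $\bar G\in S_{i+1}(M)$, $G\in\partial\bar G$, is abelian. Then: 1. If $B_i(K)$ is connected (in particular nonempty), then $\Psi_i$ acts regularly on $[k]$ and has exactly $k$ elements. 2. The permutation representation of $\Psi_i$ decomposes into one-dimensional representations $\varrho_1=1,\varrho_2,\dots,\varrho_k$: there is an invertible complex matrix $T$ with $T^{-1}P^gT=\operatorname{diag}(\varrho_1(g),\dots,\varrho_k(g))$ for all $g\in\Psi_i$, where $P^g$ has $(a,b)$ entry $1$ if $a=g(b)$ and $0$ otherwise. 3. For every such decomposition and all incidence weightings $\omega_2,\dots,\omega_k$ of $M$ with $\omega_j(F,\bar F)=\varrho_j(\psi(F,\bar F))$ whenever $F\in S_i(M)$, $\bar F\in S_{i+1}(M)$, $F\in\partial\bar F$, as a multiset union, $$\operatorname{Spec}\mathcal L_i^{\rm up}(K)=\operatorname{Spec}\mathcal L_i^{\rm up}(M)\cup\bigcup_{j=2}^k\operatorname{Spec}\mathcal L_i^{\rm up}(M,\omega_j).$$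 -/

import Mathlib

open scoped ComplexConjugate

noncomputable section

namespace SimplicialCovering

/-! ### Faces, weights and incidences

The vertex type of an `AbstractSimplicialComplex V` is exactly its set of `0`-faces, and the empty
simplex is implicit (faces are nonempty), so an `n`-face is a face with `n + 1` vertices. -/

section Complex

variable {V : Type*} [DecidableEq V]

/-- The set `S_n(K)` of `n`-faces. -/
def Face (K : AbstractSimplicialComplex V) (n : ℕ) : Type _ :=
  {F : Finset V // F ∈ K ∧ F.card = n + 1}

/-- The vertex-edge graph (the 1-skeleton without the empty simplex). -/
def skeletonGraph (K : AbstractSimplicialComplex V) : SimpleGraph V where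
  Adj u v := u ≠ v ∧ ({u, v} : Finset V) ∈ K
  symm := ⟨fun u v h => ⟨h.1.symm, by rw [Finset.pair_comm]; exact h.2⟩⟩
  loopless := ⟨fun _ h => h.1 rfl⟩

/-- `F ∈ ∂ G`: both are faces, and `F` is obtained from `G` by deleting one vertex. -/
def Incident (K : AbstractSimplicialComplex V) (F G : Finset V) : Prop :=
  F ∈ K ∧ G ∈ K ∧ F ⊆ G ∧ G.card = F.card + 1

/-- A positive weight on the faces. -/
structure FaceWeight (K : AbstractSimplicialComplex V) where
  toFun : Finset V → ℝ
  pos : ∀ F ∈ K, 0 < toFun F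

/-- The weighting `ω` of an incidence-weighted complex `(K, ω)`: it is nonzero on incidences and zero
on all other pairs. -/
structure IncidenceWeight (K : AbstractSimplicialComplex V) where
  toFun : Finset V → Finset V → ℂ
  ne_zero_iff : ∀ F G, toFun F G ≠ 0 ↔ Incident K F G

open Classical in
/-- The incidence weighting that is `1` on all incidences, for which `(K, 1)` is the ordinary
complex `K`. -/
def IncidenceWeight.trivial (K : AbstractSimplicialComplex V) : IncidenceWeight K where
  toFun F G := if Incident K F G then 1 else 0
  ne_zero_iff F G := by simp

/-! ### Oriented faces and cochains -/

/-- An `n`-face together with an ordering `[v_0, ..., v_n]` of its vertices. -/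
def OrderedFace (K : AbstractSimplicialComplex V) (n : ℕ) : Type _ :=
  {v : Fin (n + 1) → V // Function.Injective v ∧ Finset.univ.image v ∈ K}

namespace OrderedFace

variable {K : AbstractSimplicialComplex V} {n : ℕ}

instance [Fintype V] : Finite (OrderedFace K n) :=
  inferInstanceAs (Finite {_v : Fin (n + 1) → V // _})

instance [Fintype V] : Fintype (OrderedFace K n) := Fintype.ofFinite _

/-- The underlying unordered face. -/
def face (v : OrderedFace K n) : Finset V := Finset.univ.image v.1

theorem face_mem (v : OrderedFace K n) : v.face ∈ K := v.2.2

/-- Reordering the vertices: `[v_{σ 0}, ..., v_{σ n}]`. -/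
def reorder (v : OrderedFace K n) (σ : Equiv.Perm (Fin (n + 1))) : OrderedFace K n :=
  ⟨v.1 ∘ σ, v.2.1.comp σ.injective, by
    have h : Finset.univ.image (v.1 ∘ σ) = Finset.univ.image v.1 := by
      rw [← Finset.image_image, Finset.image_univ_equiv]
    rw [h]; exact v.2.2⟩

theorem face_reorder (v : OrderedFace K n) (σ : Equiv.Perm (Fin (n + 1))) :
    (v.reorder σ).face = v.face := by
  unfold face reorder
  rw [← Finset.image_image, Finset.image_univ_equiv]

/-- Omitting the `j`-th vertex. -/
def drop (v : OrderedFace K (n + 1)) (j : Fin (n + 2)) : OrderedFace K n :=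
  ⟨v.1 ∘ j.succAbove, v.2.1.comp Fin.succAbove_right_injective, by
    refine (K.isRelLowerSet_faces v.2.2).2 ?_ ?_
    · rw [← Finset.image_image]
      exact Finset.image_subset_image (Finset.subset_univ _)
    · exact Finset.univ_nonempty.image _⟩

end OrderedFace

/-- Alternating functions on ordered `n`-faces. These are exactly the linear functionals on the
space of `n`-chains (oriented faces modulo the relation that opposite orientations add up to `0`). -/
def alternatingFunctions (K : AbstractSimplicialComplex V) (n : ℕ) :
    Submodule ℂ (OrderedFace K n → ℂ) where
  carrier := {f | ∀ v σ, f (v.reorder σ) = ((Equiv.Perm.sign σ : ℤ) : ℂ) * f v}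
  add_mem' hf hg v σ := by simp only [Pi.add_apply, hf v σ, hg v σ]; ring
  zero_mem' v σ := by simp
  smul_mem' c f hf v σ := by simp only [Pi.smul_apply, smul_eq_mul, hf v σ]; ring

/-- The cochain space `C^n(K, ℂ)`; the weight `w` determines its inner product (below). -/
def Cochain (K : AbstractSimplicialComplex V) (_w : FaceWeight K) (n : ℕ) : Type _ :=
  alternatingFunctions K n

namespace Cochain

variable {K : AbstractSimplicialComplex V} {w : FaceWeight K} {n : ℕ}

instance : AddCommGroup (Cochain K w n) :=
  inferInstanceAs (AddCommGroup (alternatingFunctions K n))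

instance : Module ℂ (Cochain K w n) :=
  inferInstanceAs (Module ℂ (alternatingFunctions K n))

instance [Fintype V] : FiniteDimensional ℂ (Cochain K w n) :=
  inferInstanceAs (FiniteDimensional ℂ (alternatingFunctions K n))

/-- The cochain with given values. -/
def mk (f : OrderedFace K n → ℂ)
    (hf : ∀ v σ, f (v.reorder σ) = ((Equiv.Perm.sign σ : ℤ) : ℂ) * f v) : Cochain K w n :=
  ⟨f, hf⟩

/-- The value `f([v_0, ..., v_n])`. -/
def val (f : Cochain K w n) (v : OrderedFace K n) : ℂ := f.1 v

@[ext] theorem ext {f g : Cochain K w n} (h : ∀ v, f.val v = g.val v) : f = g :=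
  Subtype.ext (funext h)

theorem val_reorder (f : Cochain K w n) (v : OrderedFace K n) (σ : Equiv.Perm (Fin (n + 1))) :
    f.val (v.reorder σ) = ((Equiv.Perm.sign σ : ℤ) : ℂ) * f.val v := f.2 v σ

@[simp] theorem val_mk (f : OrderedFace K n → ℂ)
    (hf : ∀ v σ, f (v.reorder σ) = ((Equiv.Perm.sign σ : ℤ) : ℂ) * f v) (v : OrderedFace K n) :
    (mk f hf : Cochain K w n).val v = f v := rfl

@[simp] theorem val_zero (v : OrderedFace K n) : (0 : Cochain K w n).val v = 0 := rfl

@[simp] theorem val_add (f g : Cochain K w n) (v : OrderedFace K n) :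
    (f + g).val v = f.val v + g.val v := rfl

@[simp] theorem val_smul (c : ℂ) (f : Cochain K w n) (v : OrderedFace K n) :
    (c • f).val v = c * f.val v := rfl

variable [Fintype V]

/-- The inner product `∑_F w(F) f([F]) conj (g([F]))` over the `n`-faces `F`, conjugate-linear in the
first variable as in Mathlib. The summand does not depend on the ordering of the vertices of `F`, and
each face has `(n + 1)!` orderings. -/
abbrev innerCore (K : AbstractSimplicialComplex V) (w : FaceWeight K) (n : ℕ) :
    InnerProductSpace.Core ℂ (Cochain K w n) where
  inner f g := ((n + 1).factorial : ℂ)⁻¹ *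
    ∑ v : OrderedFace K n, (w.toFun v.face : ℂ) * (conj (f.val v) * g.val v)
  conj_inner_symm f g := by
    simp only [map_mul, map_sum, map_inv₀, map_natCast, Complex.conj_ofReal, Complex.conj_conj]
    congr 1
    exact Finset.sum_congr rfl fun v _ => by ring
  re_inner_nonneg f := by
    have h : ((n + 1).factorial : ℂ)⁻¹ *
        ∑ v : OrderedFace K n, (w.toFun v.face : ℂ) * (conj (f.val v) * f.val v) =
        ((((n + 1).factorial : ℝ)⁻¹ *
          ∑ v : OrderedFace K n, w.toFun v.face * Complex.normSq (f.val v) : ℝ) : ℂ) := by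
      push_cast
      simp only [Complex.normSq_eq_conj_mul_self]
    rw [h, RCLike.re_eq_complex_re, Complex.ofReal_re]
    exact mul_nonneg (by positivity) (Finset.sum_nonneg fun v _ =>
      mul_nonneg (w.pos _ v.face_mem).le (Complex.normSq_nonneg _))
  add_left f g h := by
    rw [← mul_add, ← Finset.sum_add_distrib]
    congr 1
    exact Finset.sum_congr rfl fun v _ => by simp only [val_add, map_add]; ring
  smul_left f g c := by
    rw [mul_left_comm, Finset.mul_sum (a := conj c)]
    congr 1
    exact Finset.sum_congr rfl fun v _ => by simp only [val_smul, map_mul]; ring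
  definite f hf := by
    have h : ((n + 1).factorial : ℂ)⁻¹ *
        ∑ v : OrderedFace K n, (w.toFun v.face : ℂ) * (conj (f.val v) * f.val v) =
        ((((n + 1).factorial : ℝ)⁻¹ *
          ∑ v : OrderedFace K n, w.toFun v.face * Complex.normSq (f.val v) : ℝ) : ℂ) := by
      push_cast
      simp only [Complex.normSq_eq_conj_mul_self]
    have h0 := h.symm.trans hf
    rw [Complex.ofReal_eq_zero] at h0
    have h1 := (mul_eq_zero.mp h0).resolve_left (by positivity)
    rw [Finset.sum_eq_zero_iff_of_nonneg fun v _ =>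
      mul_nonneg (w.pos _ v.face_mem).le (Complex.normSq_nonneg _)] at h1
    ext v
    exact Complex.normSq_eq_zero.mp
      ((mul_eq_zero.mp (h1 v (Finset.mem_univ v))).resolve_left (w.pos _ v.face_mem).ne')

instance : NormedAddCommGroup (Cochain K w n) := (innerCore K w n).toNormedAddCommGroup

instance : InnerProductSpace ℂ (Cochain K w n) := InnerProductSpace.ofCore (innerCore K w n).toCore

theorem inner_eq (f g : Cochain K w n) : inner ℂ f g = ((n + 1).factorial : ℂ)⁻¹ *
    ∑ v : OrderedFace K n, (w.toFun v.face : ℂ) * (conj (f.val v) * g.val v) := rfl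

end Cochain

/-! ### Coboundary maps and Laplace operators -/

/-- The permutation which `σ` induces between the complements of `j` and of `σ j`. -/
def inducedPerm {n : ℕ} (σ : Equiv.Perm (Fin (n + 2))) (j : Fin (n + 2)) :
    Equiv.Perm (Fin (n + 1)) :=
  (Equiv.Perm.decomposeFin ((σ j).cycleRange * σ * j.cycleRange⁻¹)).2

theorem inducedPerm_spec {n : ℕ} (σ : Equiv.Perm (Fin (n + 2))) (j : Fin (n + 2)) :
    (∀ a, σ (j.succAbove a) = (σ j).succAbove (inducedPerm σ j a)) ∧
      (-1 : ℤ) ^ (j : ℕ) * (Equiv.Perm.sign (inducedPerm σ j) : ℤ) =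
        (Equiv.Perm.sign σ : ℤ) * (-1) ^ ((σ j : Fin (n + 2)) : ℕ) := by
  set τ : Equiv.Perm (Fin (n + 2)) := (σ j).cycleRange * σ * j.cycleRange⁻¹ with hτ
  have h0 : τ 0 = 0 := by
    rw [hτ, Equiv.Perm.mul_apply, Equiv.Perm.mul_apply, Equiv.Perm.inv_def,
      Fin.cycleRange_symm_zero, Fin.cycleRange_self]
  obtain ⟨⟨p, e⟩, hpe⟩ : ∃ x, Equiv.Perm.decomposeFin τ = x := ⟨_, rfl⟩
  have he : inducedPerm σ j = e := by
    change (Equiv.Perm.decomposeFin τ).2 = e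
    rw [hpe]
  have hτe : τ = Equiv.Perm.decomposeFin.symm (p, e) := by
    rw [← hpe, Equiv.symm_apply_apply]
  have hp : p = 0 := by
    rw [hτe, Equiv.Perm.decomposeFin_symm_apply_zero] at h0
    exact h0
  subst hp
  rw [he]
  constructor
  · intro a
    have h1 : τ a.succ = (e a).succ := by
      rw [hτe, Equiv.Perm.decomposeFin_symm_apply_succ]
      simp
    rw [hτ] at h1
    simp only [Equiv.Perm.mul_apply, Equiv.Perm.inv_def, Fin.cycleRange_symm_succ] at h1
    rw [← Fin.cycleRange_symm_succ (σ j), ← h1, Equiv.symm_apply_apply]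
  · have h2 : Equiv.Perm.sign τ = Equiv.Perm.sign e := by
      rw [hτe, Equiv.Perm.decomposeFin.symm_sign]
      simp
    rw [← h2, hτ]
    simp only [map_mul, Equiv.Perm.sign_inv, Fin.sign_cycleRange]
    push_cast
    have h3 : ((-1 : ℤ) ^ (j : ℕ)) * (-1) ^ (j : ℕ) = 1 := by
      rw [← mul_pow]; simp
    linear_combination ((-1 : ℤ) ^ ((σ j : Fin (n + 2)) : ℕ) * (Equiv.Perm.sign σ : ℤ)) * h3

theorem OrderedFace.drop_reorder {K : AbstractSimplicialComplex V} {n : ℕ}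
    (v : OrderedFace K (n + 1)) (σ : Equiv.Perm (Fin (n + 2))) (j : Fin (n + 2)) :
    (v.reorder σ).drop j = (v.drop (σ j)).reorder (inducedPerm σ j) := by
  apply Subtype.ext
  funext a
  exact congrArg v.1 ((inducedPerm_spec σ j).1 a)

/-- The weighted coboundary map
`(δ^ω f)([v_0, ..., v_{n+1}]) = ∑_j (-1)^j ω(F_j, F) f([v_0, ..., v̂_j, ..., v_{n+1}])`, where
`F = {v_0, ..., v_{n+1}}` and `F_j = F \ {v_j}`. -/
def coboundary (K : AbstractSimplicialComplex V) (w : FaceWeight K) (ω : IncidenceWeight K) (n : ℕ) :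
    Cochain K w n →ₗ[ℂ] Cochain K w (n + 1) where
  toFun f := Cochain.mk (fun v => ∑ j : Fin (n + 2),
      (-1) ^ (j : ℕ) * ω.toFun (v.drop j).face v.face * f.val (v.drop j)) <| by
    intro v σ
    rw [Finset.mul_sum]
    refine Eq.trans (Finset.sum_congr rfl fun j _ => ?_) (Equiv.sum_comp σ _)
    rw [v.drop_reorder σ j, OrderedFace.face_reorder, OrderedFace.face_reorder,
      Cochain.val_reorder]
    have h := congrArg (Int.cast : ℤ → ℂ) (inducedPerm_spec σ j).2
    push_cast at h
    linear_combination (ω.toFun (v.drop (σ j)).face v.face * f.val (v.drop (σ j))) * h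
  map_add' f g := by
    ext v
    simp only [Cochain.val_add, Cochain.val_mk, ← Finset.sum_add_distrib, mul_add]
  map_smul' c f := by
    ext v
    simp only [Cochain.val_smul, Cochain.val_mk, RingHom.id_apply, Finset.mul_sum]
    exact Finset.sum_congr rfl fun j _ => mul_left_comm _ _ _

theorem coboundary_val (K : AbstractSimplicialComplex V) (w : FaceWeight K) (ω : IncidenceWeight K)
    (n : ℕ) (f : Cochain K w n) (v : OrderedFace K (n + 1)) :
    (coboundary K w ω n f).val v = ∑ j : Fin (n + 2),
      (-1) ^ (j : ℕ) * ω.toFun (v.drop j).face v.face * f.val (v.drop j) := rfl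

variable [Fintype V]

/-- The `n`-up Laplace operator `(δ^ω)^* δ^ω` of the incidence-weighted complex `(K, ω)`. -/
def weightedUpLaplacian (K : AbstractSimplicialComplex V) (w : FaceWeight K)
    (ω : IncidenceWeight K) (n : ℕ) : Cochain K w n →ₗ[ℂ] Cochain K w n :=
  LinearMap.adjoint (coboundary K w ω n) ∘ₗ coboundary K w ω n

/-- The `n`-up Laplace operator of `K`. -/
def upLaplacian (K : AbstractSimplicialComplex V) (w : FaceWeight K) (n : ℕ) :
    Cochain K w n →ₗ[ℂ] Cochain K w n :=
  weightedUpLaplacian K w (IncidenceWeight.trivial K) n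

/-- The spectrum of an operator on a finite-dimensional space: the multiset of its eigenvalues. -/
def Spec {E : Type*} [AddCommGroup E] [Module ℂ E] [FiniteDimensional ℂ E] (L : E →ₗ[ℂ] E) :
    Multiset ℂ :=
  L.charpoly.roots

/-! ### Incidence graphs -/

/-- Adjacency in the incidence graph: one of the two faces lies in the boundary of the other. -/
def incidenceAdj (K : AbstractSimplicialComplex V) (n : ℕ) :
    Face K n ⊕ Face K (n + 1) → Face K n ⊕ Face K (n + 1) → Prop
  | .inl F, .inr G => Incident K F.1 G.1
  | .inr G, .inl F => Incident K F.1 G.1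
  | _, _ => False

/-- The `n`-th incidence graph `B_n(K)`. -/
def incidenceGraph (K : AbstractSimplicialComplex V) (n : ℕ) :
    SimpleGraph (Face K n ⊕ Face K (n + 1)) where
  Adj := incidenceAdj K n
  symm := ⟨by rintro (F | F) (G | G) h <;> exact h⟩
  loopless := ⟨by rintro (F | F) h <;> exact h⟩

/-- The face of `K` which a vertex of `B_n(K)` is. -/
def toFace {K : AbstractSimplicialComplex V} {n : ℕ} : Face K n ⊕ Face K (n + 1) → Finset V
  | .inl F => F.1
  | .inr G => G.1

end Complex

/-! ### Coverings -/

section Covering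

variable {V W : Type*} [DecidableEq V] [DecidableEq W]

/-- `φ : K → M` is a strong covering: `K` is connected, `φ` is a simplicial map, and for every face
`G` of `M` the preimage `φ⁻¹(G)` is the union of the faces `F` of `K` over `G`, which are pairwise
disjoint and mapped bijectively to `G`; moreover, if `G ∈ ∂ G'` and `F` lies over `G`, then `F ∈ ∂ F'`
for some face `F'` over `G'`. -/
structure IsStrongCovering (K : AbstractSimplicialComplex V) (M : AbstractSimplicialComplex W)
    (φ : V → W) : Prop where
  connected : (skeletonGraph K).Connected
  map_mem : ∀ F ∈ K, F.image φ ∈ M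
  injOn : ∀ F ∈ K, Set.InjOn φ (F : Set V)
  disjoint : ∀ F ∈ K, ∀ F' ∈ K, F.image φ = F'.image φ → F ≠ F' → Disjoint F F'
  preimage_eq : ∀ G ∈ M,
    φ ⁻¹' (G : Set W) = ⋃ F ∈ {F : Finset V | F ∈ K ∧ F.image φ = G}, (F : Set V)
  lift : ∀ G G', Incident M G G' → ∀ F ∈ K, F.image φ = G →
    ∃ F' ∈ K, Incident K F F' ∧ F'.image φ = G'

/-- A `k`-fold covering: a strong covering such that every face of `M` has exactly `k` faces of `K`
over it. -/
structure IsFoldCovering (K : AbstractSimplicialComplex V) (M : AbstractSimplicialComplex W)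
    (φ : V → W) (k : ℕ) : Prop extends IsStrongCovering K M φ where
  fiber : ∀ G ∈ M, {F : Finset V | F ∈ K ∧ F.image φ = G}.ncard = k

end Covering

/-! ### Permutation voltages and derived graphs -/

/-- A permutation assignment on the arcs of (the symmetric digraph of) a graph, with inverse
permutations on opposite arcs. The values on pairs that are not arcs are irrelevant. -/
structure PermVoltage {X : Type*} (B : SimpleGraph X) (k : ℕ) where
  toFun : X → X → Equiv.Perm (Fin k)
  inv_eq : ∀ u v, B.Adj u v → toFun v u = (toFun u v)⁻¹

/-- The derived graph `B^ψ`: `(u, a)` and `(v, b)` are adjacent iff `u` and `v` are adjacent and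
`a = ψ(u, v)(b)`. -/
def derivedGraph {X : Type*} {B : SimpleGraph X} {k : ℕ} (ψ : PermVoltage B k) :
    SimpleGraph (X × Fin k) where
  Adj p q := B.Adj p.1 q.1 ∧ p.2 = ψ.toFun p.1 q.1 q.2
  symm := ⟨fun p q h => ⟨h.1.symm, by
    rw [ψ.inv_eq p.1 q.1 h.1, h.2]; simp⟩⟩
  loopless := ⟨fun p h => B.loopless.irrefl p.1 h.1⟩

section Voltage

variable {W : Type*} [DecidableEq W] {M : AbstractSimplicialComplex W} {i k : ℕ}

/-- The voltage group `Ψ_i`, generated by the permutations `ψ(G, G')` with `G ∈ ∂ G'`. -/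
def voltageGroup (ψ : PermVoltage (incidenceGraph M i) k) : Subgroup (Equiv.Perm (Fin k)) :=
  Subgroup.closure {g | ∃ (G : Face M i) (G' : Face M (i + 1)),
    Incident M G.1 G'.1 ∧ ψ.toFun (.inl G) (.inr G') = g}

/-- `ψ(G, G')` as an element of the voltage group. -/
def voltage (ψ : PermVoltage (incidenceGraph M i) k) (G : Face M i) (G' : Face M (i + 1))
    (h : Incident M G.1 G'.1) : voltageGroup ψ :=
  ⟨ψ.toFun (.inl G) (.inr G'), Subgroup.subset_closure ⟨G, G', h, rfl⟩⟩

end Voltage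

/-- The permutation matrix `P^g`, with `(a, b)` entry `1` if `a = g(b)` and `0` otherwise. -/
def permutationMatrix {k : ℕ} (g : Equiv.Perm (Fin k)) : Matrix (Fin k) (Fin k) ℂ :=
  Matrix.of fun a b => if a = g b then 1 else 0

/-- The invertible matrix `T` decomposes the permutation representation `g ↦ P^g` of `Ψ` into the
one-dimensional representations `ϱ_0 = 1, ϱ_1, ..., ϱ_{k-1}`. -/
structure IsCharacterDecomposition {k : ℕ} [NeZero k] (Ψ : Subgroup (Equiv.Perm (Fin k)))
    (ϱ : Fin k → (Ψ →* ℂˣ)) (T : Matrix (Fin k) (Fin k) ℂ) : Prop where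
  isUnit : IsUnit T
  first : ϱ 0 = 1
  decomp : ∀ g : Ψ, T⁻¹ * permutationMatrix (g : Equiv.Perm (Fin k)) * T =
    Matrix.diagonal fun j => ((ϱ j g : ℂˣ) : ℂ)

end SimplicialCovering

end

open SimplicialCovering

namespace SimplicialCovering

open scoped ComplexConjugate

/-! ### Linear algebra -/

/-! The isomorphism `η` labels the faces of `K` over each `i`- or `(i+1)`-face of `M` by `Fin k`, so
a cochain on `K` in these degrees is a family of `k` cochains on `M`. Deleting a vertex of a face
over `G'` with label `l` gives the face over `G` with label `ψ(G, G') l`. Thus the coboundary of `K`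
is that of `M` with each incidence twisted by a permutation of the labels
(`exists_orderedLift_pair`).

These permutations commute and have finite order, so over `ℂ` they are simultaneously diagonalizable
(`span_jointEigenvectors`). A row `s` of `T⁻¹` satisfies `s (g b) = ϱ g * s b`; hence lifting `f` to
`s l * f u` turns the coboundary of `M` weighted by `ϱ ∘ ψ` into the coboundary of `K`
(`OrderedLift.coboundary_pullback`). Since `T` need not be unitary, this lift need not be an
isometry up to scale, nor need the `k` lifts have orthogonal images. Its adjoint, a weighted sum
over fibres, also commutes with the coboundaries because characters of finite groups have modulus
one (`OrderedLift.pushforward_coboundary`), and this suffices to intertwine the Laplacians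
(`eq_comp_of_adjoint_intertwine`). Invertibility of `T` makes the `k` lifts together an isomorphism
(`OrderedLift.exists_linearEquiv`), so characteristic polynomials multiply and spectra add up.

For regularity, connectedness of the derived graph makes the voltage group transitive on labels, and
in a transitive abelian group a permutation is determined by one value. -/

theorem charpoly_blockDiagonal {R n o : Type*} [CommRing R] [Fintype n] [DecidableEq n]
    [Fintype o] [DecidableEq o] (A : o → Matrix n n R) :
    (Matrix.blockDiagonal A).charpoly = ∏ j, (A j).charpoly := by
  have h : (Matrix.blockDiagonal A).charmatrix =
      Matrix.blockDiagonal fun j => (A j).charmatrix := by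
    ext ⟨a, j⟩ ⟨b, l⟩ : 2
    by_cases hjl : j = l
    · subst hjl
      simp [Matrix.charmatrix_apply, Matrix.blockDiagonal_apply, Matrix.diagonal_apply]
    · simp [Matrix.blockDiagonal_apply, hjl]
  simp only [Matrix.charpoly, h, Matrix.det_blockDiagonal]

theorem charpoly_pi {R E o : Type*} [CommRing R] [AddCommGroup E] [Module R E]
    [Module.Free R E] [Module.Finite R E] [Fintype o] (f : o → E →ₗ[R] E) :
    (LinearMap.pi fun j => (f j).comp (LinearMap.proj j)).charpoly = ∏ j, (f j).charpoly := by
  classical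
  let b := Module.Free.chooseBasis R E
  -- `Pi.basis` is indexed by (component, basis index), `Matrix.blockDiagonal` by (index within
  -- block, block), hence the swap.
  let B := (Pi.basis fun _ : o => b).reindex <|
    (Equiv.sigmaEquivProd _ _).trans (Equiv.prodComm _ _)
  have h : LinearMap.toMatrix B B (LinearMap.pi fun j => (f j).comp (LinearMap.proj j)) =
      Matrix.blockDiagonal fun j => LinearMap.toMatrix b b (f j) := by
    ext ⟨i₁, i₂⟩ ⟨j₁, j₂⟩
    unfold B
    simp_rw [LinearMap.toMatrix_apply', Matrix.blockDiagonal_apply, Module.Basis.coe_reindex,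
      Function.comp_apply, Module.Basis.repr_reindex_apply, Equiv.symm_trans_apply,
      Equiv.prodComm_symm, Equiv.prodComm_apply, Equiv.sigmaEquivProd_symm_apply,
      Prod.swap_prod_mk, Pi.basis_apply, Pi.basis_repr, LinearMap.pi_apply, LinearMap.coe_comp,
      Function.comp_apply, LinearMap.toMatrix_apply', LinearMap.coe_proj, Function.eval,
      Pi.single_apply]
    split_ifs with h
    · rw [h]
    · simp only [map_zero, Finsupp.coe_zero, Pi.zero_apply]
  rw [← LinearMap.charpoly_toMatrix _ B, h, charpoly_blockDiagonal]
  simp only [LinearMap.charpoly_toMatrix]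

/-- Intertwining with the coproduct of operators by an equivalence makes the spectrum a union. -/
theorem spec_eq_sum {E E' : Type*} [AddCommGroup E] [Module ℂ E] [FiniteDimensional ℂ E]
    [AddCommGroup E'] [Module ℂ E'] [FiniteDimensional ℂ E'] {o : Type*} [Fintype o]
    (U : (o → E) ≃ₗ[ℂ] E') (L' : E' →ₗ[ℂ] E') (L : o → E →ₗ[ℂ] E)
    (h : ∀ f, L' (U f) = U fun j => L j (f j)) :
    Spec L' = ∑ j, Spec (L j) := by
  have hc : L' = U.conj (LinearMap.pi fun j => (L j).comp (LinearMap.proj j)) := by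
    ext x
    obtain ⟨f, rfl⟩ := U.surjective x
    rw [h, LinearEquiv.conj_apply_apply, LinearEquiv.symm_apply_apply]
    rfl
  have h0 : ∏ j, (L j).charpoly ≠ 0 :=
    Finset.prod_ne_zero_iff.mpr fun j _ => (LinearMap.charpoly_monic (L j)).ne_zero
  rw [Spec, hc, LinearEquiv.charpoly_conj, charpoly_pi, Polynomial.roots_prod _ _ h0]
  rfl

/-- Here `V` and `V₁` are the adjoints of `U` and `U₁`. Pairing with `y` gives `⟨d' y, d' U x⟩ = ⟨d'
y, U₁ d x⟩ = ⟨V₁ d' y, d x⟩ = ⟨d V y, d x⟩`, and `V` moves back to the other side as `U`. No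
unitarity is needed. -/
theorem eq_comp_of_adjoint_intertwine {E E' F F' : Type*}
    [NormedAddCommGroup E] [InnerProductSpace ℂ E] [FiniteDimensional ℂ E]
    [NormedAddCommGroup E'] [InnerProductSpace ℂ E'] [FiniteDimensional ℂ E']
    [NormedAddCommGroup F] [InnerProductSpace ℂ F] [FiniteDimensional ℂ F]
    [NormedAddCommGroup F'] [InnerProductSpace ℂ F'] [FiniteDimensional ℂ F']
    (d : E →ₗ[ℂ] F) (d' : E' →ₗ[ℂ] F') (U : E →ₗ[ℂ] E') (U₁ : F →ₗ[ℂ] F')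
    (V : E' →ₗ[ℂ] E) (V₁ : F' →ₗ[ℂ] F)
    (hV : ∀ x y, inner ℂ (V x) y = inner ℂ x (U y))
    (hV₁ : ∀ x y, inner ℂ (V₁ x) y = inner ℂ x (U₁ y))
    (hU : ∀ x, d' (U x) = U₁ (d x)) (hd : ∀ x, V₁ (d' x) = d (V x)) (x : E) :
    (LinearMap.adjoint d' ∘ₗ d') (U x) = U ((LinearMap.adjoint d ∘ₗ d) x) := by
  refine ext_inner_left ℂ fun y => ?_
  rw [LinearMap.comp_apply, LinearMap.adjoint_inner_right, hU, ← hV₁, hd,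
    ← hV, LinearMap.comp_apply, LinearMap.adjoint_inner_right]

/-! ### Abelian permutation groups -/

theorem existsUnique_apply_eq_of_transitive {X : Type*} (Ψ : Subgroup (Equiv.Perm X))
    (hab : ∀ g ∈ Ψ, ∀ h ∈ Ψ, g * h = h * g)
    (htr : ∀ a b : X, ∃ g ∈ Ψ, g a = b) (a b : X) :
    ∃! g : Ψ, (g : Equiv.Perm X) a = b := by
  obtain ⟨g, hg, rfl⟩ := htr a b
  refine ⟨⟨g, hg⟩, rfl, fun h hh => Subtype.ext (Equiv.ext fun c => ?_)⟩
  -- With `t` carrying `a` to `c`, commuting with `t` transports the agreement of `h` and `g` at `a`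
  -- to `c`.
  obtain ⟨t, ht, rfl⟩ := htr a c
  have h1 := DFunLike.congr_fun (hab _ h.2 t ht) a
  have h2 := DFunLike.congr_fun (hab g hg t ht) a
  simp only [Equiv.Perm.mul_apply] at h1 h2
  rw [h1, hh, h2]

theorem card_eq_of_existsUnique_apply_eq {k : ℕ} [NeZero k]
    (Ψ : Subgroup (Equiv.Perm (Fin k)))
    (h : ∀ a b : Fin k, ∃! g : Ψ, (g : Equiv.Perm (Fin k)) a = b) : Nat.card Ψ = k := by
  have hb : Function.Bijective fun g : Ψ => (g : Equiv.Perm (Fin k)) 0 :=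
    (Function.bijective_iff_existsUnique _).mpr (h 0)
  rw [Nat.card_eq_of_bijective _ hb, Nat.card_eq_fintype_card, Fintype.card_fin]

/-- The action of a permutation on functions. -/
def permAction {X : Type*} (g : Equiv.Perm X) : Module.End ℂ (X → ℂ) :=
  LinearMap.funLeft ℂ ℂ (g⁻¹ : Equiv.Perm X)

theorem permAction_apply {X : Type*} (g : Equiv.Perm X) (v : X → ℂ) (a : X) :
    permAction g v a = v (g⁻¹ a) := rfl

/-- The inverse in `permAction` makes it a homomorphism and makes its standard matrix equal to
`permutationMatrix g`. -/
theorem permAction_mul {X : Type*} (g h : Equiv.Perm X) :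
    permAction (g * h) = permAction g * permAction h := by
  ext v a
  simp [permAction_apply]

theorem permAction_one {X : Type*} : permAction (1 : Equiv.Perm X) = 1 := by
  ext v a
  simp [permAction_apply]

theorem permAction_pow {X : Type*} (g : Equiv.Perm X) (m : ℕ) :
    permAction (g ^ m) = permAction g ^ m := by
  induction m with
  | zero => simp [permAction_one]
  | succ m ih => rw [pow_succ, permAction_mul, ih, pow_succ]

/-- A permutation of a finite set is annihilated by `X ^ m - 1`, with `m` its order, and this
polynomial is separable in characteristic zero. -/
theorem permAction_isSemisimple {X : Type*} [Finite X] (g : Equiv.Perm X) :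
    (permAction g).IsSemisimple := by
  refine Module.End.isSemisimple_of_squarefree_aeval_eq_zero
    (p := Polynomial.X ^ orderOf g - 1) ?_ ?_
  · refine (Polynomial.X_pow_sub_one_separable_iff.mpr ?_).squarefree
    exact_mod_cast (orderOf_pos g).ne'
  · simp [← permAction_pow, pow_orderOf_eq_one, permAction_one]

/-- The nonzero joint eigenvectors of a set of permutations. -/
def jointEigenvectors {X : Type*} (Ψ : Subgroup (Equiv.Perm X)) : Set (X → ℂ) :=
  {v | v ≠ 0 ∧ ∀ g ∈ Ψ, ∃ c : ℂ, permAction g v = c • v}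

/-- Commuting operators over `ℂ` have joint generalized eigenspaces that span; semisimplicity turns
these into genuine eigenspaces. -/
theorem span_jointEigenvectors {X : Type*} [Finite X] (Ψ : Subgroup (Equiv.Perm X))
    (hab : ∀ g ∈ Ψ, ∀ h ∈ Ψ, g * h = h * g) :
    Submodule.span ℂ (jointEigenvectors Ψ) = ⊤ := by
  have h := Module.End.iSup_iInf_maxGenEigenspace_eq_top_of_iSup_maxGenEigenspace_eq_top_of_commute
    (fun g : Ψ => permAction (g : Equiv.Perm X))
    (fun g h _ => by
      change permAction _ * permAction _ = permAction _ * permAction _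
      rw [← permAction_mul, hab _ g.2 _ h.2, permAction_mul])
    (fun g => Module.End.iSup_maxGenEigenspace_eq_top _)
  rw [eq_top_iff, ← h]
  refine iSup_le fun χ v hv => ?_
  rcases eq_or_ne v 0 with rfl | hv0
  · exact zero_mem _
  refine Submodule.subset_span ⟨hv0, fun g hg => ⟨χ ⟨g, hg⟩, ?_⟩⟩
  have hvg := (Submodule.mem_iInf _).mp hv ⟨g, hg⟩
  rw [(permAction_isSemisimple g).isFinitelySemisimple.maxGenEigenspace_eq_eigenspace] at hvg
  exact Module.End.mem_eigenspace_iff.mp hvg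

/-- Since `v ≠ 0`, each eigenvalue is determined by the action, so the eigenvalues inherit
multiplicativity from it; having a group as source makes them units. -/
theorem exists_character_of_mem_jointEigenvectors {X : Type*} (Ψ : Subgroup (Equiv.Perm X))
    {v : X → ℂ} (hv : v ∈ jointEigenvectors Ψ) :
    ∃ χ : Ψ →* ℂˣ, ∀ g : Ψ, permAction (g : Equiv.Perm X) v = (χ g : ℂ) • v := by
  obtain ⟨hv0, hv⟩ := hv
  choose c hc using fun g : Ψ => hv g g.2
  have hmul : ∀ g h, c (g * h) = c g * c h := fun g h => by
    refine smul_left_injective ℂ hv0 ?_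
    change c (g * h) • v = (c g * c h) • v
    rw [← hc, Subgroup.coe_mul, permAction_mul, Module.End.mul_apply, hc h, map_smul, hc g,
      smul_smul, mul_comm]
  have hone : c 1 = 1 := by
    refine smul_left_injective ℂ hv0 ?_
    change c 1 • v = (1 : ℂ) • v
    rw [← hc, Subgroup.coe_one, permAction_one, one_smul, Module.End.one_apply]
  refine ⟨MonoidHom.toHomUnits ⟨⟨c, hone⟩, hmul⟩, fun g => ?_⟩
  simpa using hc g

/-- The columns of `T` form a basis of joint eigenvectors. The constant function is fixed by every
permutation and supplies the trivial character. -/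
theorem exists_isCharacterDecomposition {k : ℕ} [NeZero k] (Ψ : Subgroup (Equiv.Perm (Fin k)))
    (hab : ∀ g ∈ Ψ, ∀ h ∈ Ψ, g * h = h * g) :
    ∃ ϱ T, IsCharacterDecomposition Ψ ϱ T := by
  have h1 : (1 : Fin k → ℂ) ∈ jointEigenvectors Ψ :=
    ⟨one_ne_zero, fun g _ => ⟨1, by ext a; simp [permAction_apply]⟩⟩
  -- Extend the constant function, inside the spanning set of joint eigenvectors, to a basis.
  obtain ⟨s, hs, h1s, hsp, hli⟩ := exists_linearIndepOn_id_extension (K := ℂ)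
    (s := {(1 : Fin k → ℂ)}) (LinearIndepOn.singleton (v := id) one_ne_zero)
    (Set.singleton_subset_iff.mpr h1)
  have hspan : ⊤ ≤ Submodule.span ℂ (Set.range ((↑) : s → Fin k → ℂ)) := by
    rw [Subtype.range_coe, ← span_jointEigenvectors Ψ hab]
    exact Submodule.span_le.mpr hsp
  let b := Module.Basis.mk (v := ((↑) : s → Fin k → ℂ)) hli hspan
  let e₀ : s ≃ Fin k := b.indexEquiv (Pi.basisFun ℂ (Fin k))
  -- The swap gives the constant function index `0`, as `first` requires.
  let e := e₀.trans (Equiv.swap (e₀ ⟨1, h1s rfl⟩) 0)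
  have he : e.symm 0 = ⟨1, h1s rfl⟩ := by
    rw [Equiv.symm_apply_eq]; simp [e]
  let B := b.reindex e
  have hB : ∀ j, B j = (e.symm j : Fin k → ℂ) := fun j => by
    exact (b.reindex_apply e j).trans (Module.Basis.mk_apply hli hspan _)
  choose ϱ hϱ using fun j : Fin k =>
    exists_character_of_mem_jointEigenvectors Ψ (hs (e.symm j).2)
  let T : Matrix (Fin k) (Fin k) ℂ := (Pi.basisFun ℂ (Fin k)).toMatrix B
  have hTa : ∀ a j, T a j = (e.symm j : Fin k → ℂ) a := fun a j => by
    simp [T, Module.Basis.toMatrix_apply, hB]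
  have hT : IsUnit T := by
    let := (Pi.basisFun ℂ (Fin k)).invertibleToMatrix B
    exact isUnit_of_invertible T
  refine ⟨ϱ, T, hT, ?_, fun g => ?_⟩
  · ext g
    have h := congrFun (hϱ 0 g) 0
    rw [he] at h
    simpa [permAction_apply] using h.symm
  · have h : permutationMatrix (g : Equiv.Perm (Fin k)) * T =
        T * Matrix.diagonal fun j => ((ϱ j g : ℂˣ) : ℂ) := by
      ext a j
      have h2 := congrFun (hϱ j g) a
      rw [permAction_apply, Pi.smul_apply, smul_eq_mul] at h2
      rw [Matrix.mul_diagonal, Matrix.mul_apply, hTa, mul_comm, ← h2,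
        Finset.sum_eq_single ((g : Equiv.Perm (Fin k))⁻¹ a)]
      · simp [permutationMatrix, hTa]
      · rintro c - hc
        have : a ≠ (g : Equiv.Perm (Fin k)) c := by
          rintro rfl; simp at hc
        simp [permutationMatrix, this]
      · simp
    rw [mul_assoc, h, Matrix.nonsing_inv_mul_cancel_left _ _ ((Matrix.isUnit_iff_isUnit_det T).mp hT)]

/-- The rows of `T⁻¹` transform under the characters. -/
theorem IsCharacterDecomposition.inv_apply {k : ℕ} [NeZero k] {Ψ : Subgroup (Equiv.Perm (Fin k))}
    {ϱ : Fin k → (Ψ →* ℂˣ)} {T : Matrix (Fin k) (Fin k) ℂ} (h : IsCharacterDecomposition Ψ ϱ T)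
    (g : Ψ) (j b : Fin k) :
    T⁻¹ j ((g : Equiv.Perm (Fin k)) b) = ((ϱ j g : ℂˣ) : ℂ) * T⁻¹ j b := by
  have h1 : T⁻¹ * permutationMatrix (g : Equiv.Perm (Fin k)) =
      Matrix.diagonal (fun j => ((ϱ j g : ℂˣ) : ℂ)) * T⁻¹ := by
    rw [← h.decomp g, mul_assoc,
      Matrix.mul_nonsing_inv _ ((Matrix.isUnit_iff_isUnit_det T).mp h.isUnit), mul_one]
  have h2 := congrFun (congrFun h1 j) b
  rw [Matrix.diagonal_mul, Matrix.mul_apply] at h2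
  simpa [permutationMatrix] using h2

/-- Character values of a finite group are roots of unity. This lets the adjoint of a pullback
commute with the coboundaries. -/
theorem conj_mul_character {G : Type*} [Group G] [Finite G] (χ : G →* ℂˣ) (g : G) :
    conj (χ g : ℂ) * (χ g : ℂ) = 1 := by
  have h : ((χ g : ℂˣ) : ℂ) ^ Nat.card G = 1 := by
    rw [← Units.val_pow_eq_pow_val, ← map_pow, pow_card_eq_one', map_one, Units.val_one]
  have hn := Complex.norm_eq_one_of_pow_eq_one h Nat.card_pos.ne'
  rw [← Complex.normSq_eq_conj_mul_self, Complex.normSq_eq_norm_sq, hn]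
  simp

section

variable {V W : Type*} [DecidableEq V] [DecidableEq W]
  {K : AbstractSimplicialComplex V} {M : AbstractSimplicialComplex W}

/-! ### Ordered faces over ordered faces -/

theorem OrderedFace.card_face {n : ℕ} (v : OrderedFace K n) : v.face.card = n + 1 := by
  rw [OrderedFace.face, Finset.card_image_of_injective _ v.2.1, Finset.card_univ, Fintype.card_fin]

/-- The unordered face as an element of `S_n(K)`. -/
def OrderedFace.toFace {n : ℕ} (v : OrderedFace K n) : Face K n :=
  ⟨v.face, v.face_mem, v.card_face⟩

theorem OrderedFace.toFace_reorder {n : ℕ} (v : OrderedFace K n)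
    (σ : Equiv.Perm (Fin (n + 1))) : (v.reorder σ).toFace = v.toFace :=
  Subtype.ext (v.face_reorder σ)

theorem OrderedFace.face_drop_subset {n : ℕ} (v : OrderedFace K (n + 1)) (j : Fin (n + 2)) :
    (v.drop j).face ⊆ v.face := by
  change Finset.univ.image (v.1 ∘ j.succAbove) ⊆ Finset.univ.image v.1
  rw [← Finset.image_image]
  exact Finset.image_subset_image (Finset.subset_univ _)

theorem OrderedFace.incident_drop {n : ℕ} (v : OrderedFace K (n + 1)) (j : Fin (n + 2)) :
    Incident K (v.drop j).face v.face :=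
  ⟨(v.drop j).face_mem, v.face_mem, v.face_drop_subset j, by rw [v.card_face, (v.drop j).card_face]⟩

/-- An ordering of a face is determined by the image ordering, if the map is injective on it. -/
theorem OrderedFace.eq_of_comp_eq {X : Type*} {φ : V → X} {n : ℕ} {v v' : OrderedFace K n}
    (hφ : Set.InjOn φ (v.face : Set V)) (hface : v.face = v'.face) (h : φ ∘ v.1 = φ ∘ v'.1) :
    v = v' := by
  refine Subtype.ext (funext fun a => hφ ?_ ?_ (congrFun h a))
  · exact Finset.mem_coe.mpr (Finset.mem_image_of_mem _ (Finset.mem_univ _))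
  · rw [hface]
    exact Finset.mem_coe.mpr (Finset.mem_image_of_mem _ (Finset.mem_univ _))

/-- An ordering of the image of a face lifts to the face. -/
theorem OrderedFace.exists_lift {φ : V → W} {n : ℕ} (F : Face K n) (u : OrderedFace M n)
    (h : F.1.image φ = u.face) : ∃ v : OrderedFace K n, v.toFace = F ∧ φ ∘ v.1 = u.1 := by
  have hm : ∀ a, ∃ x ∈ F.1, φ x = u.1 a := fun a => by
    rw [← Finset.mem_image, h]
    exact Finset.mem_image_of_mem _ (Finset.mem_univ _)
  choose x hxF hx using hm
  have hinj : Function.Injective x := fun a b hab => u.2.1 (by rw [← hx, ← hx, hab])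
  have himg : Finset.univ.image x = F.1 := by
    refine Finset.eq_of_subset_of_card_le (Finset.image_subset_iff.mpr fun a _ => hxF a) ?_
    rw [F.2.2, Finset.card_image_of_injective _ hinj, Finset.card_univ, Fintype.card_fin]
  exact ⟨⟨x, hinj, by rw [himg]; exact F.2.1⟩, Subtype.ext himg, funext hx⟩

/-- A bijection between the ordered faces of `K` and `k` copies of those of `M` which commutes with
reorderings and preserves the weights. -/
structure OrderedLift (wK : FaceWeight K) (wM : FaceWeight M) (n k : ℕ) where
  equiv : OrderedFace M n × Fin k ≃ OrderedFace K n
  reorder : ∀ u l σ, equiv (u.reorder σ, l) = (equiv (u, l)).reorder σ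
  weight : ∀ u l, wK.toFun (equiv (u, l)).face = wM.toFun u.face

/-- A labelling of the faces over each face of `M` lifts to ordered faces. -/
theorem exists_orderedLift {wK : FaceWeight K} {wM : FaceWeight M} {φ : V → W} {n k : ℕ}
    (hinj : ∀ F ∈ K, Set.InjOn φ (F : Set V))
    (hw : ∀ F ∈ K, wK.toFun F = wM.toFun (F.image φ))
    (e : Face M n × Fin k ≃ Face K n) (he : ∀ p, (e p).1.image φ = p.1.1) :
    ∃ Θ : OrderedLift wK wM n k, ∀ u l,
      φ ∘ (Θ.equiv (u, l)).1 = u.1 ∧ (Θ.equiv (u, l)).toFace = e (u.toFace, l) := by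
  choose θ hθ hφθ using fun p : OrderedFace M n × Fin k =>
    OrderedFace.exists_lift (φ := φ) (e (p.1.toFace, p.2)) p.1 (he _)
  have hbij : Function.Bijective θ := by
    constructor
    · rintro ⟨u, l⟩ ⟨u', l'⟩ h
      have h1 : u = u' := Subtype.ext (by rw [← hφθ (u, l), h, hφθ])
      have h2 : e (u.toFace, l) = e (u'.toFace, l') := by rw [← hθ (u, l), h, hθ]
      have h3 := e.injective h2
      rw [h1, (Prod.mk.inj h3).2]
    · intro v
      obtain ⟨⟨G, l⟩, hG⟩ := e.surjective v.toFace
      have hv : v.face.image φ = Finset.univ.image (φ ∘ v.1) := by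
        rw [OrderedFace.face, Finset.image_image]
      have hGv : Finset.univ.image (φ ∘ v.1) = G.1 := by
        rw [← hv, ← he (G, l), hG]; rfl
      let u : OrderedFace M n := ⟨φ ∘ v.1, fun a b hab => v.2.1 (hinj _ v.face_mem
        (Finset.mem_coe.mpr (Finset.mem_image_of_mem _ (Finset.mem_univ _)))
        (Finset.mem_coe.mpr (Finset.mem_image_of_mem _ (Finset.mem_univ _))) hab), by
          rw [hGv]; exact G.2.1⟩
      have hu : u.toFace = G := Subtype.ext hGv
      refine ⟨(u, l), OrderedFace.eq_of_comp_eq (hinj _ (OrderedFace.face_mem _)) ?_ (hφθ _)⟩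
      exact congrArg Subtype.val ((hθ (u, l)).trans (by rw [hu, hG]))
  refine ⟨⟨Equiv.ofBijective θ hbij, fun u l σ => ?_, fun u l => ?_⟩,
    fun u l => ⟨hφθ (u, l), hθ (u, l)⟩⟩
  · refine OrderedFace.eq_of_comp_eq (hinj _ (OrderedFace.face_mem _)) ?_ ?_
    · rw [OrderedFace.face_reorder]
      exact congrArg Subtype.val ((hθ (u.reorder σ, l)).trans
        ((congrArg (fun G => e (G, l)) (u.toFace_reorder σ)).trans (hθ (u, l)).symm))
    · refine (hφθ (u.reorder σ, l)).trans ?_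
      change u.1 ∘ σ = (φ ∘ (θ (u, l)).1) ∘ σ
      rw [hφθ]
  · rw [hw _ (OrderedFace.face_mem _)]
    have h : (θ (u, l)).face = (e (u.toFace, l)).1 := congrArg Subtype.val (hθ (u, l))
    change wM.toFun ((θ (u, l)).face.image φ) = _
    rw [h, he]
    rfl

/-! ### Pulling back and pushing forward cochains -/

namespace OrderedLift

variable {wK : FaceWeight K} {wM : FaceWeight M} {n k : ℕ} (Θ : OrderedLift wK wM n k)

/-- Pulling back a cochain, with a factor for each label. -/
def pullback (s : Fin k → ℂ) : Cochain M wM n →ₗ[ℂ] Cochain K wK n where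
  toFun f := Cochain.mk (fun v => s (Θ.equiv.symm v).2 * f.val (Θ.equiv.symm v).1) <| by
    intro v σ
    obtain ⟨⟨u, l⟩, rfl⟩ := Θ.equiv.surjective v
    rw [← Θ.reorder, Equiv.symm_apply_apply, Equiv.symm_apply_apply, Cochain.val_reorder]
    exact mul_left_comm _ _ _
  map_add' f g := by
    ext v
    simp only [Cochain.val_add, Cochain.val_mk, mul_add]
  map_smul' c f := by
    ext v
    simp only [Cochain.val_smul, Cochain.val_mk, RingHom.id_apply]
    exact mul_left_comm _ _ _

theorem pullback_val (s : Fin k → ℂ) (f : Cochain M wM n) (u : OrderedFace M n) (l : Fin k) :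
    (Θ.pullback s f).val (Θ.equiv (u, l)) = s l * f.val u := by
  change s (Θ.equiv.symm _).2 * f.val (Θ.equiv.symm _).1 = _
  rw [Equiv.symm_apply_apply]

/-- The adjoint of `pullback`. -/
def pushforward (s : Fin k → ℂ) : Cochain K wK n →ₗ[ℂ] Cochain M wM n where
  toFun h := Cochain.mk (fun u => ∑ l, conj (s l) * h.val (Θ.equiv (u, l))) <| by
    intro v σ
    simp only [Θ.reorder, Cochain.val_reorder, Finset.mul_sum]
    exact Finset.sum_congr rfl fun _ _ => mul_left_comm _ _ _
  map_add' f g := by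
    ext v
    simp only [Cochain.val_add, Cochain.val_mk, mul_add, Finset.sum_add_distrib]
  map_smul' c f := by
    ext v
    simp only [Cochain.val_smul, Cochain.val_mk, RingHom.id_apply, Finset.mul_sum]
    exact Finset.sum_congr rfl fun _ _ => mul_left_comm _ _ _

theorem pushforward_val (s : Fin k → ℂ) (h : Cochain K wK n) (u : OrderedFace M n) :
    (Θ.pushforward s h).val u = ∑ l, conj (s l) * h.val (Θ.equiv (u, l)) := rfl

theorem inner_pushforward_left [Fintype V] [Fintype W] (s : Fin k → ℂ) (h : Cochain K wK n)
    (f : Cochain M wM n) :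
    inner ℂ (Θ.pushforward s h) f = inner ℂ h (Θ.pullback s f) := by
  rw [Cochain.inner_eq, Cochain.inner_eq, ← Equiv.sum_comp Θ.equiv, Fintype.sum_prod_type]
  congr 1
  refine Finset.sum_congr rfl fun u _ => ?_
  rw [pushforward_val, map_sum, Finset.sum_mul, Finset.mul_sum]
  refine Finset.sum_congr rfl fun l _ => ?_
  rw [pullback_val, Θ.weight, map_mul, Complex.conj_conj]
  ring

/-- The values on the fibres of a combination of pullbacks are given by an invertible matrix, so all
cochains on `K` are obtained. -/
theorem exists_linearEquiv (S T : Matrix (Fin k) (Fin k) ℂ) (hST : S * T = 1) :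
    ∃ U : (Fin k → Cochain M wM n) ≃ₗ[ℂ] Cochain K wK n,
      ∀ f, U f = ∑ j, Θ.pullback (S j) (f j) := by
  have hTS : T * S = 1 := mul_eq_one_comm.mp hST
  let U : (Fin k → Cochain M wM n) →ₗ[ℂ] Cochain K wK n :=
    ∑ j, (Θ.pullback (S j)).comp (LinearMap.proj j)
  -- The inverse of `U`; the conjugate cancels the one built into `pushforward`, leaving the
  -- coefficients `T l j`.
  let R : Cochain K wK n →ₗ[ℂ] (Fin k → Cochain M wM n) :=
    LinearMap.pi fun j => Θ.pushforward fun l => conj (T l j)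
  have sum_val : ∀ {o : Type} (t : Finset o) (g : o → Cochain K wK n) (v : OrderedFace K n),
      (∑ j ∈ t, g j).val v = ∑ j ∈ t, (g j).val v := fun t g v =>
    map_sum (⟨⟨fun f => f.val v, rfl⟩, fun _ _ => rfl⟩ : Cochain K wK n →+ ℂ) g t
  have hU : ∀ f, U f = ∑ j, Θ.pullback (S j) (f j) := fun f => by
    simp [U, LinearMap.sum_apply]
  have hUv : ∀ f u l, (U f).val (Θ.equiv (u, l)) = ∑ j, S j l * (f j).val u := fun f u l => by
    rw [hU, sum_val]
    exact Finset.sum_congr rfl fun j _ => Θ.pullback_val _ _ _ _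
  have hRv : ∀ h u j, (R h j).val u = ∑ l, T l j * h.val (Θ.equiv (u, l)) := fun h u j => by
    change (Θ.pushforward _ h).val u = _
    simp only [pushforward_val, Complex.conj_conj]
  refine ⟨LinearEquiv.ofLinearMap U R ?_ ?_, hU⟩
  · ext h v
    obtain ⟨⟨u, l⟩, rfl⟩ := Θ.equiv.surjective v
    change (U (R h)).val _ = h.val _
    simp only [hUv, hRv, Finset.mul_sum]
    rw [Finset.sum_comm]
    have h1 : ∀ m, ∑ j, S j l * (T m j * h.val (Θ.equiv (u, m))) =
        (1 : Matrix (Fin k) (Fin k) ℂ) m l * h.val (Θ.equiv (u, m)) := fun m => by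
      rw [← hTS, Matrix.mul_apply, Finset.sum_mul]
      exact Finset.sum_congr rfl fun j _ => by ring
    simp only [h1, Matrix.one_apply]
    simp
  · refine LinearMap.ext fun f => funext fun j => Cochain.ext fun u => ?_
    change (R (U f) j).val u = (f j).val u
    simp only [hUv, hRv, Finset.mul_sum]
    rw [Finset.sum_comm]
    have h1 : ∀ m, ∑ l, T l j * (S m l * (f m).val u) =
        (1 : Matrix (Fin k) (Fin k) ℂ) m j * (f m).val u := fun m => by
      rw [← hST, Matrix.mul_apply, Finset.sum_mul]
      exact Finset.sum_congr rfl fun j _ => by ring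
    simp only [h1, Matrix.one_apply]
    simp

variable {Θ}
variable {Θ₁ : OrderedLift wK wM (n + 1) k}
  {p : OrderedFace M (n + 1) → Fin (n + 2) → Equiv.Perm (Fin k)}
  (hp : ∀ u l j, (Θ₁.equiv (u, l)).drop j = Θ.equiv (u.drop j, p u j l))
  {s : Fin k → ℂ} {ω : IncidenceWeight M}
  (hs : ∀ u j l, s (p u j l) = ω.toFun (u.drop j).face u.face * s l)

include hp hs

/-- Dropping vertex `j` moves the label by `p u j`, and `hs` says that `s` turns this move into the
factor `ω`. -/
theorem coboundary_pullback (f : Cochain M wM n) :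
    coboundary K wK (IncidenceWeight.trivial K) n (Θ.pullback s f) =
      Θ₁.pullback s (coboundary M wM ω n f) := by
  ext v
  obtain ⟨⟨u, l⟩, rfl⟩ := Θ₁.equiv.surjective v
  rw [pullback_val, coboundary_val, coboundary_val, Finset.mul_sum]
  refine Finset.sum_congr rfl fun j _ => ?_
  have h1 : (IncidenceWeight.trivial K).toFun ((Θ₁.equiv (u, l)).drop j).face
      (Θ₁.equiv (u, l)).face = 1 := if_pos (OrderedFace.incident_drop _ j)
  rw [h1, hp, pullback_val, hs]
  ring

/-- Here the label sum is reindexed by `p u j`, which produces `conj ω` beside the `ω` of the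
coboundary on `M`; the two cancel only because `ω` has modulus one on incidences. -/
theorem pushforward_coboundary
    (hω : ∀ (u : OrderedFace M (n + 1)) j, conj (ω.toFun (u.drop j).face u.face) *
      ω.toFun (u.drop j).face u.face = 1) (h : Cochain K wK n) :
    Θ₁.pushforward s (coboundary K wK (IncidenceWeight.trivial K) n h) =
      coboundary M wM ω n (Θ.pushforward s h) := by
  ext u
  rw [pushforward_val, coboundary_val]
  simp only [coboundary_val, Finset.mul_sum]
  rw [Finset.sum_comm]
  refine Finset.sum_congr rfl fun j _ => ?_
  rw [pushforward_val, ← Equiv.sum_comp (p u j) fun l => conj (s l) * h.val (Θ.equiv (u.drop j, l)),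
    Finset.mul_sum]
  refine Finset.sum_congr rfl fun l _ => ?_
  have h1 : (IncidenceWeight.trivial K).toFun ((Θ₁.equiv (u, l)).drop j).face
      (Θ₁.equiv (u, l)).face = 1 := if_pos (OrderedFace.incident_drop _ j)
  rw [h1, hp, hs, map_mul]
  linear_combination (-(conj (s l) * (-1) ^ (j : ℕ) * h.val (Θ.equiv (u.drop j, p u j l)))) * hω u j

end OrderedLift

/-- The spectrum of the up Laplacian of a complex with lifted faces, when a matrix decomposes all
permutations of the labels. -/
theorem spec_upLaplacian_eq_sum [Fintype V] [Fintype W] {wK : FaceWeight K} {wM : FaceWeight M}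
    {n k : ℕ} (Θ : OrderedLift wK wM n k) (Θ₁ : OrderedLift wK wM (n + 1) k)
    (p : OrderedFace M (n + 1) → Fin (n + 2) → Equiv.Perm (Fin k))
    (hp : ∀ u l j, (Θ₁.equiv (u, l)).drop j = Θ.equiv (u.drop j, p u j l))
    (S T : Matrix (Fin k) (Fin k) ℂ) (hST : S * T = 1) (ω : Fin k → IncidenceWeight M)
    (hs : ∀ m u j l, S m (p u j l) = (ω m).toFun (u.drop j).face u.face * S m l)
    (hω : ∀ m (u : OrderedFace M (n + 1)) j, conj ((ω m).toFun (u.drop j).face u.face) *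
      (ω m).toFun (u.drop j).face u.face = 1) :
    Spec (upLaplacian K wK n) = ∑ j, Spec (weightedUpLaplacian M wM (ω j) n) := by
  obtain ⟨U, hU⟩ := Θ.exists_linearEquiv S T hST
  refine spec_eq_sum U _ _ fun f => ?_
  rw [hU, hU, map_sum]
  refine Finset.sum_congr rfl fun m _ => ?_
  exact eq_comp_of_adjoint_intertwine _ _ (Θ.pullback (S m)) (Θ₁.pullback (S m))
    (Θ.pushforward (S m)) (Θ₁.pushforward (S m)) (Θ.inner_pushforward_left _)
    (Θ₁.inner_pushforward_left _) (OrderedLift.coboundary_pullback hp (hs m))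
    (OrderedLift.pushforward_coboundary hp (hs m) (hω m)) (f m)

end

section

variable {V W : Type*}
  {K : AbstractSimplicialComplex V} {M : AbstractSimplicialComplex W} {i k : ℕ}

/-! ### Derived graphs of incidence graphs -/

theorem toFace_mem {n : ℕ} (x : Face K n ⊕ Face K (n + 1)) : toFace x ∈ K := by
  rcases x with F | F
  · exact F.2.1
  · exact F.2.1

theorem card_toFace {n : ℕ} (x : Face K n ⊕ Face K (n + 1)) :
    (toFace x).card = n + 1 ↔ x.isLeft := by
  rcases x with F | F
  · simp [toFace, F.2.2]
  · simp [toFace, F.2.2]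

theorem toFace_injective {n : ℕ} :
    Function.Injective (toFace : Face K n ⊕ Face K (n + 1) → Finset V) := by
  rintro (F | F) (G | G) h
  · exact congrArg Sum.inl (Subtype.ext h)
  · have h1 : F.1.card = G.1.card := congrArg Finset.card h
    rw [F.2.2, G.2.2] at h1
    omega
  · have h1 : F.1.card = G.1.card := congrArg Finset.card h
    rw [F.2.2, G.2.2] at h1
    omega
  · exact congrArg Sum.inr (Subtype.ext h)

/-- An isomorphism from the derived graph to the incidence graph of the covering complex respects
the dimension, so it consists of two bijections. -/
theorem exists_faceEquiv [DecidableEq W] {φ : V → W} (hinj : ∀ F ∈ K, Set.InjOn φ (F : Set V))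
    (η : (Face M i ⊕ Face M (i + 1)) × Fin k ≃ Face K i ⊕ Face K (i + 1))
    (hη : ∀ x l, (toFace (η (x, l))).image φ = toFace x) :
    ∃ (e₀ : Face M i × Fin k ≃ Face K i) (e₁ : Face M (i + 1) × Fin k ≃ Face K (i + 1)),
      (∀ G l, η (.inl G, l) = .inl (e₀ (G, l))) ∧ ∀ G l, η (.inr G, l) = .inr (e₁ (G, l)) := by
  -- `φ` is injective on faces, so `η` preserves cardinality and hence the side of the bipartition.
  have hleft : ∀ x l, (η (x, l)).isLeft = x.isLeft := fun x l => by
    rw [Bool.eq_iff_iff, ← card_toFace, ← card_toFace, ← hη x l,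
      Finset.card_image_of_injOn (hinj _ (toFace_mem _))]
  have h0 : ∀ p : Face M i × Fin k, ∃ F, η (.inl p.1, p.2) = .inl F := fun p =>
    Sum.isLeft_iff.mp (hleft _ _)
  have h1 : ∀ p : Face M (i + 1) × Fin k, ∃ F, η (.inr p.1, p.2) = .inr F := fun p =>
    Sum.isRight_iff.mp (by rw [← Sum.not_isLeft, hleft]; simp)
  choose e₀ he₀ using h0
  choose e₁ he₁ using h1
  refine ⟨Equiv.ofBijective e₀ ⟨fun p q h => ?_, fun F => ?_⟩,
    Equiv.ofBijective e₁ ⟨fun p q h => ?_, fun F => ?_⟩, fun G l => he₀ (G, l),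
    fun G l => he₁ (G, l)⟩
  · have h2 := η.injective ((he₀ p).trans ((congrArg Sum.inl h).trans (he₀ q).symm))
    exact Prod.ext (Sum.inl_injective (Prod.mk.inj h2).1) (Prod.mk.inj h2).2
  · obtain ⟨⟨x | x, l⟩, hx⟩ := η.surjective (.inl F)
    · exact ⟨(x, l), Sum.inl_injective ((he₀ (x, l)).symm.trans hx)⟩
    · cases (he₁ (x, l)).symm.trans hx
  · have h2 := η.injective ((he₁ p).trans ((congrArg Sum.inr h).trans (he₁ q).symm))
    exact Prod.ext (Sum.inr_injective (Prod.mk.inj h2).1) (Prod.mk.inj h2).2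
  · obtain ⟨⟨x | x, l⟩, hx⟩ := η.surjective (.inr F)
    · cases (he₀ (x, l)).symm.trans hx
    · exact ⟨(x, l), Sum.inr_injective ((he₁ (x, l)).symm.trans hx)⟩

theorem voltage_mem (ψ : PermVoltage (incidenceGraph M i) k) {x y : Face M i ⊕ Face M (i + 1)}
    (h : (incidenceGraph M i).Adj x y) : ψ.toFun x y ∈ voltageGroup ψ := by
  rcases x with G | G' <;> rcases y with H | H'
  · exact h.elim
  · exact (voltage ψ G H' h).2
  · rw [ψ.inv_eq _ _ h.symm]
    exact inv_mem (voltage ψ H G' h).2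
  · exact h.elim

/-- Labels which are joined in the derived graph are related by the voltage group. -/
theorem exists_voltageGroup_apply_eq_of_reachable (ψ : PermVoltage (incidenceGraph M i) k)
    {p q : (Face M i ⊕ Face M (i + 1)) × Fin k} (h : (derivedGraph ψ).Reachable p q) :
    ∃ g ∈ voltageGroup ψ, g q.2 = p.2 := by
  obtain ⟨c⟩ := h
  induction c with
  | nil => exact ⟨1, one_mem _, rfl⟩
  | cons h _ ih =>
    obtain ⟨g, hg, hgq⟩ := ih
    exact ⟨_, mul_mem (voltage_mem ψ h.1) hg, by rw [Equiv.Perm.mul_apply, hgq, ← h.2]⟩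

/-- The vertices of the faces over an ordered face can be ordered in the same way, and the labels of
a face and its boundary faces differ by the voltages. -/
theorem exists_orderedLift_pair [DecidableEq V] [DecidableEq W] {wK : FaceWeight K}
    {wM : FaceWeight M} {φ : V → W}
    (hinj : ∀ F ∈ K, Set.InjOn φ (F : Set V))
    (hw : ∀ F ∈ K, wK.toFun F = wM.toFun (F.image φ))
    (ψ : PermVoltage (incidenceGraph M i) k) (η : derivedGraph ψ ≃g incidenceGraph K i)
    (hη : ∀ x l, (toFace (η (x, l))).image φ = toFace x) :
    ∃ (Θ : OrderedLift wK wM i k) (Θ₁ : OrderedLift wK wM (i + 1) k),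
      ∀ (u : OrderedFace M (i + 1)) l j, (Θ₁.equiv (u, l)).drop j =
        Θ.equiv (u.drop j, ψ.toFun (.inl (u.drop j).toFace) (.inr u.toFace) l) := by
  obtain ⟨e₀, e₁, he₀, he₁⟩ := exists_faceEquiv hinj η.toEquiv hη
  obtain ⟨Θ, hΘ⟩ := exists_orderedLift (wK := wK) (wM := wM) hinj hw e₀ fun p =>
    (congrArg (fun x => (toFace x).image φ) (he₀ p.1 p.2)).symm.trans (hη (.inl p.1) p.2)
  obtain ⟨Θ₁, hΘ₁⟩ := exists_orderedLift (wK := wK) (wM := wM) hinj hw e₁ fun p =>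
    (congrArg (fun x => (toFace x).image φ) (he₁ p.1 p.2)).symm.trans (hη (.inr p.1) p.2)
  -- Pulling an incidence in `K` back along `η` gives an edge of the derived graph, whose definition
  -- fixes the label.
  have hvolt : ∀ G G' a b, Incident K (e₀ (G, a)).1 (e₁ (G', b)).1 →
      a = ψ.toFun (.inl G) (.inr G') b := fun G G' a b h => by
    have hadj : (incidenceGraph K i).Adj (η (.inl G, a)) (η (.inr G', b)) := by
      change (incidenceGraph K i).Adj (η.toEquiv (.inl G, a)) (η.toEquiv (.inr G', b))
      rw [he₀, he₁]
      exact h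
    exact (η.map_adj_iff.mp hadj).2
  refine ⟨Θ, Θ₁, fun u l j => ?_⟩
  -- The dropped face is the lift of some `u'` with some label `a`: its image under `φ` forces `u' =
  -- u.drop j`, and `hvolt` then forces `a`.
  obtain ⟨⟨u', a⟩, hu'⟩ := Θ.equiv.surjective ((Θ₁.equiv (u, l)).drop j)
  have hu : u' = u.drop j := by
    refine Subtype.ext ?_
    rw [← (hΘ u' a).1, hu']
    exact congrArg (fun v : Fin (i + 2) → W => v ∘ j.succAbove) (hΘ₁ u l).1
  subst hu
  have hinc := OrderedFace.incident_drop (Θ₁.equiv (u, l)) j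
  rw [← hu'] at hinc ⊢
  rw [← hvolt (u.drop j).toFace u.toFace a l (by rw [← (hΘ _ _).2, ← (hΘ₁ _ _).2]; exact hinc)]

end

end SimplicialCovering

/-! ### Regularity, characters and spectrum of a covering with abelian voltage group. -/

theorem theorem4p1 {V W : Type*} [Fintype V] [DecidableEq V] [Fintype W] [DecidableEq W]
    (K : AbstractSimplicialComplex V) (M : AbstractSimplicialComplex W)
    (wK : FaceWeight K) (wM : FaceWeight M) (i k : ℕ) [NeZero k]
    (φ : V → W) (hφ : IsFoldCovering K M φ k)
    (hw : ∀ F ∈ K, wK.toFun F = wM.toFun (F.image φ))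
    (ψ : PermVoltage (incidenceGraph M i) k)
    (η : derivedGraph ψ ≃g incidenceGraph K i)
    (hη : ∀ x l, (toFace (η (x, l))).image φ = toFace x)
    (hab : ∀ g ∈ voltageGroup ψ, ∀ h ∈ voltageGroup ψ, g * h = h * g) :
    ((incidenceGraph K i).Connected →
      (∀ a b : Fin k, ∃! g : voltageGroup ψ, (g : Equiv.Perm (Fin k)) a = b) ∧
        Nat.card (voltageGroup ψ) = k) ∧
    (∃ ϱ T, IsCharacterDecomposition (voltageGroup ψ) ϱ T) ∧
    (∀ ϱ T, IsCharacterDecomposition (voltageGroup ψ) ϱ T →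
      ∀ ω : Fin k → IncidenceWeight M,
        (∀ j, j ≠ 0 → ∀ (G : Face M i) (G' : Face M (i + 1)) (h : Incident M G.1 G'.1),
          (ω j).toFun G.1 G'.1 = ((ϱ j (voltage ψ G G' h) : ℂˣ) : ℂ)) →
        Spec (upLaplacian K wK i) = Spec (upLaplacian M wM i) +
          ∑ j ∈ Finset.univ.erase 0, Spec (weightedUpLaplacian M wM (ω j) i)) := by
  refine ⟨fun hc => ?_, exists_isCharacterDecomposition _ hab, fun ϱ T hT ω hω => ?_⟩
  · have hd : (derivedGraph ψ).Connected := (SimpleGraph.Iso.connected_iff η).mpr hc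
    have hreg := existsUnique_apply_eq_of_transitive (voltageGroup ψ) hab fun a b => by
      -- A walk from `(x, b)` to `(x, a)` over one fixed vertex `x` has a voltage product sending
      -- `a` to `b`.
      obtain ⟨x, -⟩ := hd.nonempty.some
      exact exists_voltageGroup_apply_eq_of_reachable ψ (hd.preconnected (x, b) (x, a))
    exact ⟨hreg, card_eq_of_existsUnique_apply_eq _ hreg⟩
  obtain ⟨Θ, Θ₁, hp⟩ := exists_orderedLift_pair (wK := wK) (wM := wM) hφ.injOn hw ψ η hη
  -- The hypotheses leave `ω 0` arbitrary; replacing it by the trivial weighting, which matches `ϱ 0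
  -- = 1`, treats all indices uniformly.
  let ω' : Fin k → IncidenceWeight M := Function.update ω 0 (IncidenceWeight.trivial M)
  have hω' : ∀ m (u : OrderedFace M (i + 1)) j, (ω' m).toFun (u.drop j).face u.face =
      ((ϱ m (voltage ψ (u.drop j).toFace u.toFace (u.incident_drop j)) : ℂˣ) : ℂ) :=
    fun m u j => by
      rcases eq_or_ne m 0 with rfl | hm
      · rw [hT.first]
        simp only [ω', Function.update_self]
        exact if_pos (u.incident_drop j)
      · simp only [ω', Function.update_of_ne hm]
        exact hω m hm (u.drop j).toFace u.toFace (u.incident_drop j)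
  have hsum : Spec (upLaplacian K wK i) = ∑ j, Spec (weightedUpLaplacian M wM (ω' j) i) := by
    refine spec_upLaplacian_eq_sum Θ Θ₁
      (fun u j => ψ.toFun (.inl (u.drop j).toFace) (.inr u.toFace)) hp T⁻¹ T
      (Matrix.nonsing_inv_mul _ ((Matrix.isUnit_iff_isUnit_det T).mp hT.isUnit)) ω'
      (fun m u j l => ?_) (fun m u j => ?_)
    · rw [hω']
      exact hT.inv_apply (voltage ψ (u.drop j).toFace u.toFace (u.incident_drop j)) m l
    · rw [hω']
      exact conj_mul_character _ _
  have hzero : ω' 0 = IncidenceWeight.trivial M := Function.update_self _ _ _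
  have hsucc : ∀ j ∈ Finset.univ.erase (0 : Fin k), Spec (weightedUpLaplacian M wM (ω' j) i) =
      Spec (weightedUpLaplacian M wM (ω j) i) := fun j hj => by
    rw [show ω' j = ω j from Function.update_of_ne (Finset.ne_of_mem_erase hj) _ _]
  rw [hsum, ← Finset.add_sum_erase _ _ (Finset.mem_univ (0 : Fin k)), Finset.sum_congr rfl hsucc,
    hzero, upLaplacian]
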